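/- Let $d\ge 1$ and, for $j\in\{1,\dots,2d\}$, put $j^*=2d+1-j$. Let $I(d,2d)$ be the set of $d$-element subsets of $\{1,\dots,2d\}$, and let $I(d)$ be the set of those $v\in I(d,2d)$ that contain exactly one of $j,j^*$ for every $j\in\{1,\dots,2d\}$. Fix $\beta\in I(d)$. An *extended upper $\beta$-chain* is a (possibly empty) finite sequence $C=\big((r_1,c_1),\dots,(r_k,c_k)\big)$ of pairs with $r_i\in\{1,\dots,2d\}\setminus\beta$, $c_i\in\beta$, $r_i\le c_i^*$, such that $r_i>r_{i+1}$ and $c_i<c_{i+1}$ for $1\le i<k$. Let $C^{\#}$ be the multiset $\{(c^*,r^*) : (r,c)\in C\}$, and let $C\cup C^{\#}$ be the union of multisets, in which multiplicities are added. *Bounded RSK.* A notched bitableau $(P,Q)$ is a finite list of rows $(P_1,Q_1),\dots,(P_r,Q_r)$, from top to bottom, where $P_i$ and $Q_i$ are finite sequences of positive integers of equal length. (a) Let $U$ be a finite multiset of pairs $(a,b)$ of positive integers, all with $a<b$. List its elements as $(a_1,b_1),\dots,(a_t,b_t)$ with $b_1\ge\dots\ge b_t$, and with $a_i\ge a_{i+1}$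 whenever $b_i=b_{i+1}$. Start with the empty bitableau, and for $i=1,\dots,t$ carry out the following step with $(a,b)=(a_i,b_i)$. Insert $a$ into the first row of $P$: if that row has an entry $x$ with $a\le x<b$, replace the smallest such $x$ by $a$ and insert $x$ into the next row in the same way, with the same $b$; otherwise put $a$ into the row immediately after its entries $<b$ and before its entries $\ge b$, place $b$ at the left end of the row of $Q$ with the same number, and stop. If no row is left, the number being inserted forms a new bottom row of $P$, and $b$ forms the corresponding row of $Q$. The result after $t$ steps is $BRSK(U)$. (b) If all $(a,b)\in U$ have $a>b$, then $BRSK(U)$ is obtained from $BRSK(\{(b,a):(a,b)\in U\})$ by interchanging $P$ and $Q$ and reversing the order of the rows. (c) If all $(a,b)\in U$ have $a\ne b$, then $BRSK(U)$ is obtained by placing $BRSK(U^-)$ on top of $BRSK(U^+)$, where $U^-$ and $U^+$ consist of the elements of $U$ with $a<b$ and with $a>b$, respectively. For a row $(R,S)$ of $BRSK(C\cup C^{\#})$ put $R-S:=(\beta\setminus S)\cup R$, regarding $R$ and $S$ as sets. Let $(P^C_1,Q^C_1)$ be the topmost row and $(P^C_r,Q^C_r)$ the bottom-most row of $BRSK(C\cup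 C^{\#})$, and define $$top(\mathfrak w(C^+)):=P^C_r-Q^C_r,\qquad bot(\mathfrak w(C^-)):=P^C_1-Q^C_1 ;$$ if $C$ is empty, there are no rows and both are taken to be $\beta$. **Theorem.** For every extended upper $\beta$-chain $C$, both $top(\mathfrak w(C^+))$ and $bot(\mathfrak w(C^-))$ belong to $I(d)$. -/

import Mathlib

/-- The involution `j ↦ j^* = 2d + 1 - j` of `{1, …, 2d}`. -/
def starIndex (d j : ℕ) : ℕ := 2 * d + 1 - j

/-- `I(d, 2d)`: the `d`-element subsets of `{1, …, 2d}`. -/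
def indexSets (d : ℕ) : Set (Finset ℕ) :=
  {v | v ⊆ Finset.Icc 1 (2 * d) ∧ v.card = d}

/-- `I(d)`: the elements of `I(d, 2d)` that contain exactly one of `j`, `j^*` for every `j` in
`{1, …, 2d}`. -/
def symplecticIndexSets (d : ℕ) : Set (Finset ℕ) :=
  {v | v ∈ indexSets d ∧ ∀ j ∈ Finset.Icc 1 (2 * d), Xor (j ∈ v) (starIndex d j ∈ v)}

/-- All pairs `(r, c)` with `r ∈ {1, …, 2d} \ β` and `c ∈ β`. -/
def rootPairs (d : ℕ) (β : Finset ℕ) : Set (ℕ × ℕ) :=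
  {x | x.1 ∈ Finset.Icc 1 (2 * d) \ β ∧ x.2 ∈ β}

/-- The pairs `(r, c)` in `rootPairs d β` on or above the diagonal, that is, with `r ≤ c^*`. -/
def upperRootPairs (d : ℕ) (β : Finset ℕ) : Set (ℕ × ℕ) :=
  {x | x ∈ rootPairs d β ∧ x.1 ≤ starIndex d x.2}

/-- The strict order on pairs: `(R, C) > (r, c)` if `R > r` and `C < c`. -/
def PairGT (x y : ℕ × ℕ) : Prop := y.1 < x.1 ∧ x.2 < y.2

/-- An extended `β`-chain is a (possibly empty) sequence `λ₁ > ⋯ > λₖ` of pairs. -/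
def IsExtendedChain (d : ℕ) (β : Finset ℕ) (C : List (ℕ × ℕ)) : Prop :=
  (∀ x ∈ C, x ∈ rootPairs d β) ∧ C.IsChain PairGT

/-- An extended upper `β`-chain is an extended `β`-chain lying in `upperRootPairs d β`. -/
def IsExtendedUpperChain (d : ℕ) (β : Finset ℕ) (C : List (ℕ × ℕ)) : Prop :=
  IsExtendedChain d β C ∧ ∀ x ∈ C, x ∈ upperRootPairs d β

/-- The multiset `U^# = {(c^*, r^*) | (r, c) ∈ U}`. -/
def hashMultiset (d : ℕ) (U : Multiset (ℕ × ℕ)) : Multiset (ℕ × ℕ) :=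
  U.map fun x => (starIndex d x.2, starIndex d x.1)

/-- A notched bitableau `(P, Q)`, given by the list of its rows `(Pᵢ, Qᵢ)` from top to bottom;
the entries of each row are listed from left to right. -/
abbrev NotchedBitableau := List (List ℕ × List ℕ)

/-- One step of the bounded RSK correspondence: the `b`-bounded insertion of `a` into `P`, with
`b` recorded at the left end of the row of `Q` in which the new box appears.

Entries of `P` that are `≥ b` are left alone.  If the first row of `P` has an entry `x` with
`a ≤ x < b`, then `a` replaces the smallest such `x` (the leftmost one, rows being strictly
increasing) and `x` is inserted into the next row in the same manner.  Otherwise `a` is added to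
the row, just after its entries `< b` and before its entries `≥ b`. -/
def boundedInsert (b : ℕ) : ℕ → NotchedBitableau → NotchedBitableau
  | a, [] => [([a], [b])]
  | a, (p, q) :: rest =>
    match p.find? (fun x => decide (a ≤ x ∧ x < b)) with
    | none => (p.filter (fun x => decide (x < b)) ++ a :: p.filter (fun x => decide (b ≤ x)),
        b :: q) :: rest
    | some x => (p.replace x a, q) :: boundedInsert b x rest

/-- The entries `(a, b)` of a multiset, listed with `b` weakly decreasing and, among equal `b`,
with `a` weakly decreasing. -/
def lexList (U : Multiset (ℕ × ℕ)) : List (ℕ × ℕ) :=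
  ((U.map fun x => toLex (x.2, x.1)).sort (· ≥ ·)).map fun y => ((ofLex y).2, (ofLex y).1)

/-- The bounded RSK correspondence on negative multisets, those with `a < b` for every entry
`(a, b)`: successive bounded insertions, starting from the empty notched bitableau. -/
def brskNeg (U : Multiset (ℕ × ℕ)) : NotchedBitableau :=
  (lexList U).foldl (fun T x => boundedInsert x.2 x.1 T) []

/-- The involution on notched bitableaux that exchanges `P` and `Q` and reverses the order of
the rows. -/
def flipBitableau (T : NotchedBitableau) : NotchedBitableau :=
  (T.map Prod.swap).reverse

/-- The negative part of a multiset of pairs. -/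
def negativePart (U : Multiset (ℕ × ℕ)) : Multiset (ℕ × ℕ) := U.filter fun x => x.1 < x.2

/-- The positive part of a multiset of pairs. -/
def positivePart (U : Multiset (ℕ × ℕ)) : Multiset (ℕ × ℕ) := U.filter fun x => x.2 < x.1

/-- The bounded RSK correspondence on positive multisets, by transport along the swap of
coordinates. -/
def brskPos (U : Multiset (ℕ × ℕ)) : NotchedBitableau :=
  flipBitableau (brskNeg (U.map Prod.swap))

/-- The bounded RSK correspondence on multisets of pairs `(a, b)` with `a ≠ b`: the image of the
negative part is placed on top of the image of the positive part. -/
def BRSK (U : Multiset (ℕ × ℕ)) : NotchedBitableau :=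
  brskNeg (negativePart U) ++ brskPos (positivePart U)

/-- `R - S = (β \ S) ∪ R` for a row `(R, S)`, where `R` is disjoint from `β` and `S ⊆ β`. -/
def rowMinus (β : Finset ℕ) (row : List ℕ × List ℕ) : Finset ℕ :=
  (β \ row.2.toFinset) ∪ row.1.toFinset

/-- The notched bitableau `BRSK(C ∪ C^#)`; the union is that of multisets (monomials), with
multiplicities added. -/
def chainBitableau (d : ℕ) (C : List (ℕ × ℕ)) : NotchedBitableau :=
  BRSK ((C : Multiset (ℕ × ℕ)) + hashMultiset d (C : Multiset (ℕ × ℕ)))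

/-- `top(𝔴(C⁺)) = P_r - Q_r`, from the bottom-most row of `BRSK(C ∪ C^#)`.  If `C` is empty there
are no rows, the row is read as empty, and the value is `β`. -/
def chainTop (d : ℕ) (β : Finset ℕ) (C : List (ℕ × ℕ)) : Finset ℕ :=
  rowMinus β ((chainBitableau d C).getLastD ([], []))

/-- `bot(𝔴(C⁻)) = P_1 - Q_1`, from the topmost row of `BRSK(C ∪ C^#)`, with the same convention
for the empty chain. -/
def chainBot (d : ℕ) (β : Finset ℕ) (C : List (ℕ × ℕ)) : Finset ℕ :=
  rowMinus β ((chainBitableau d C).headD ([], []))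

/-! Put `U = C ∪ C^#`. Its negative part is invariant under `(a, b) ↦ (b^*, a^*)`, and the goal is
that in the first and last rows `(R, S)` the entries of `R` are exactly the `j^*` with `j ∈ S`. Then
`(β \ S) ∪ R` again contains exactly one of `j`, `j^*`. For the first row, a Schensted-type theorem
(`add_countBelow_le_headRow_iff`) describes the excess of `P` over `Q` below each threshold `k` as
the maximal size of a nest of pairs with `a < k ≤ b`. Reflection preserves nests and sends `k` to
`2d + 2 - k`, so the excess is symmetric; its differences give the multiplicities of `j` and `j^*`
(`count_headRow_add`). For the last row, `U` is a union of two nests, so no three of its members are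
pairwise comparable and there are at most two rows (`length_insertAll_le_two`). The total contents
of `P` and `Q` correspond under the star, so removing the first row settles the second. The positive
part reduces to the negative one by swapping coordinates and replacing `β` by its complement. -/

/-! ### Insertion into a single row. -/

/-- Bounded insertion of `a` into a single row, recording `b` if the row grows. -/
def rowStep (b a : ℕ) (R : List ℕ × List ℕ) : List ℕ × List ℕ :=
  match R.1.find? (fun x => decide (a ≤ x ∧ x < b)) with
  | none => (R.1.filter (fun x => decide (x < b)) ++ a :: R.1.filter (fun x => decide (b ≤ x)),
      b :: R.2)
  | some x => (R.1.replace x a, R.2)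

/-- The first row evolves independently of the rows below it, so it can be studied alone through
`headRow`. -/
theorem headD_boundedInsert (b a : ℕ) (T : NotchedBitableau) :
    (boundedInsert b a T).headD ([], []) = rowStep b a (T.headD ([], [])) := by
  cases T with
  | nil => simp [boundedInsert, rowStep]
  | cons R T =>
    obtain ⟨p, q⟩ := R
    simp only [boundedInsert, rowStep, List.headD_cons]
    cases p.find? (fun x => decide (a ≤ x ∧ x < b)) <;> simp

theorem filter_lt_append_filter_le_perm (b : ℕ) (p : List ℕ) :
    (p.filter (fun x => decide (x < b)) ++ p.filter (fun x => decide (b ≤ x))).Perm p := by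
  have h := List.filter_append_perm (fun x => decide (x < b)) p
  have e : (fun x => !decide (x < b)) = (fun x => decide (b ≤ x)) := by
    funext x; rw [← decide_not]; simp
  rwa [e] at h

/-- Inserting into a strictly increasing row either adds a box, or bumps the smallest entry `x`
with `a ≤ x < b`. -/
theorem rowStep_spec {b a : ℕ} {R : List ℕ × List ℕ} (hR : R.1.Pairwise (· < ·)) (hab : a < b) :
    ∃ as bs, (rowStep b a R).1 = as ++ a :: bs ∧ (as ++ a :: bs).Pairwise (· < ·) ∧
      (((as ++ bs).Perm R.1 ∧ (∀ y ∈ bs, b ≤ y) ∧ (rowStep b a R).2 = b :: R.2 ∧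
          R.1.find? (fun x => decide (a ≤ x ∧ x < b)) = none) ∨
        ∃ x, a ≤ x ∧ x < b ∧ R.1 = as ++ x :: bs ∧ (rowStep b a R).2 = R.2 ∧
          R.1.find? (fun x => decide (a ≤ x ∧ x < b)) = some x) := by
  cases h : R.1.find? (fun x => decide (a ≤ x ∧ x < b)) with
  | none =>
    refine ⟨R.1.filter (fun x => decide (x < b)), R.1.filter (fun x => decide (b ≤ x)), ?_, ?_,
      Or.inl ⟨filter_lt_append_filter_le_perm b R.1, ?_, ?_, rfl⟩⟩
    · simp only [rowStep, h]
    · simp only [List.find?_eq_none, decide_eq_true_eq] at h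
      refine List.pairwise_append.2 ⟨hR.filter _, List.pairwise_cons.2 ⟨?_, hR.filter _⟩, ?_⟩
      · intro y hy
        have := (List.mem_filter.1 hy).2
        simp only [decide_eq_true_eq] at this
        omega
      · intro y hy z hz
        obtain ⟨hy1, hy2⟩ := List.mem_filter.1 hy
        have := h y hy1
        simp only [decide_eq_true_eq] at hy2
        rcases List.mem_cons.1 hz with rfl | hz
        · omega
        · have := (List.mem_filter.1 hz).2
          simp only [decide_eq_true_eq] at this
          omega
    · intro y hy
      simpa using (List.mem_filter.1 hy).2
    · simp only [rowStep, h]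
  | some x =>
    obtain ⟨hx, as, bs, e, has⟩ := List.find?_eq_some_iff_append.1 h
    simp only [decide_eq_true_eq] at hx
    rw [e] at hR
    obtain ⟨h1, h2, h3⟩ := List.pairwise_append.1 hR
    have hlt : ∀ y ∈ as, y < a := by
      intro y hy
      have h4 := h3 y hy x (by simp)
      have h5 := has y hy
      simp only [Bool.not_eq_true', decide_eq_false_iff_not] at h5
      omega
    have hxa : x ∉ as := fun hxm => by have := hlt x hxm; omega
    refine ⟨as, bs, ?_, ?_, Or.inr ⟨x, hx.1, hx.2, e, ?_, rfl⟩⟩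
    · simp only [rowStep, h]
      rw [e, List.replace_append, if_neg hxa]
      simp
    · refine List.pairwise_append.2 ⟨h1, List.pairwise_cons.2 ⟨?_, (List.pairwise_cons.1 h2).2⟩, ?_⟩
      · intro y hy
        have := (List.pairwise_cons.1 h2).1 y hy
        omega
      · intro y hy z hz
        rcases List.mem_cons.1 hz with rfl | hz
        · exact hlt y hy
        · exact h3 y hy z (by simp [hz])
    · simp only [rowStep, h]

theorem rowStep_pairwise {b a : ℕ} {R : List ℕ × List ℕ} (hR : R.1.Pairwise (· < ·))
    (hab : a < b) : (rowStep b a R).1.Pairwise (· < ·) := by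
  obtain ⟨as, bs, e, h, -⟩ := rowStep_spec hR hab
  rwa [e]

/-! ### Counting entries below a threshold. -/

/-- The number of entries of `l` that are smaller than `y`. -/
def countBelow (l : List ℕ) (y : ℕ) : ℕ := l.countP (fun x => decide (x < y))

theorem countBelow_append (l m : List ℕ) (y : ℕ) :
    countBelow (l ++ m) y = countBelow l y + countBelow m y := List.countP_append

theorem countBelow_cons (x : ℕ) (l : List ℕ) (y : ℕ) :
    countBelow (x :: l) y = countBelow l y + if x < y then 1 else 0 := by
  simp [countBelow, List.countP_cons]

theorem countBelow_eq_length {l : List ℕ} {y : ℕ} (h : ∀ x ∈ l, x < y) :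
    countBelow l y = l.length := List.countP_eq_length.2 (by simpa using h)

theorem countBelow_eq_zero {l : List ℕ} {y : ℕ} (h : ∀ x ∈ l, y ≤ x) :
    countBelow l y = 0 := List.countP_eq_zero.2 (by simpa using h)

theorem countBelow_succ (l : List ℕ) (y : ℕ) :
    countBelow l (y + 1) = countBelow l y + l.count y := by
  induction l with
  | nil => simp [countBelow]
  | cons x l ih =>
    rw [countBelow_cons, countBelow_cons, ih, List.count_cons]
    by_cases h : x = y
    · subst h; simp; omega
    · have : (x < y + 1) ↔ x < y := by omega
      simp [h, this]; omega

/-- The new `a` sits just after the entries smaller than `a`. If the bumped entry is below `y`, the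
count is unchanged and already large enough; otherwise no old entry lies in `[a, y)`. This is the
recurrence for maximal nest sizes, to be matched with `hasNest_concat`. -/
theorem countBelow_rowStep_of_le {b a : ℕ} {R : List ℕ × List ℕ} (hR : R.1.Pairwise (· < ·))
    (hab : a < b) {y : ℕ} (hy : y ≤ b) :
    countBelow (rowStep b a R).1 y =
      if a < y then max (countBelow R.1 y) (countBelow R.1 a + 1) else countBelow R.1 y := by
  obtain ⟨as, bs, e, h, h'⟩ := rowStep_spec hR hab
  obtain ⟨h1, h2, h3⟩ := List.pairwise_append.1 h
  have has : ∀ z ∈ as, z < a := fun z hz => h3 z hz a (by simp)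
  have hbs := (List.pairwise_cons.1 h2).1
  have c1 : countBelow as a = as.length := countBelow_eq_length has
  have c2 : countBelow bs a = 0 := countBelow_eq_zero fun z hz => (hbs z hz).le
  have c3 : a < y → countBelow as y = as.length := fun hay =>
    countBelow_eq_length fun z hz => (has z hz).trans hay
  rw [e]
  rcases h' with ⟨hp, hb, -, -⟩ | ⟨x, hax, hxb, hp, -, -⟩
  · have hc : ∀ z, countBelow R.1 z = countBelow as z + countBelow bs z := fun z => by
      rw [← countBelow_append]; exact (hp.countP_eq _).symm
    have c4 : countBelow bs y = 0 := countBelow_eq_zero fun z hz => hy.trans (hb z hz)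
    simp only [hc, countBelow_append, countBelow_cons]
    split_ifs with hay
    · rw [c3 hay]; omega
    · omega
  · have c5 : y ≤ x → countBelow bs y = 0 := fun hyx => countBelow_eq_zero fun z hz => by
      rw [hp] at hR
      have := (List.pairwise_cons.1 (List.pairwise_append.1 hR).2.1).1 z hz
      omega
    simp only [hp, countBelow_append, countBelow_cons]
    by_cases hay : a < y
    · have := c3 hay
      by_cases hxy : x < y
      · simp only [hay, hxy, if_true]; split_ifs <;> omega
      · have := c5 (by omega)
        simp only [hay, hxy, if_true, if_false]; split_ifs <;> omega
    · have : ¬ x < y := by omega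
      simp [hay, this]

/-- Bumping exchanges two entries below `y`, and growth adds one entry below `y` to both `P` and
`Q`; the excess is unaffected. -/
theorem countBelow_rowStep_of_lt {b a : ℕ} {R : List ℕ × List ℕ} (hR : R.1.Pairwise (· < ·))
    (hab : a < b) {y : ℕ} (hy : b < y) :
    countBelow (rowStep b a R).1 y + countBelow R.2 y =
      countBelow R.1 y + countBelow (rowStep b a R).2 y := by
  obtain ⟨as, bs, e, -, h'⟩ := rowStep_spec hR hab
  rw [e]
  have hay : a < y := by omega
  rcases h' with ⟨hp, -, e2, -⟩ | ⟨x, -, hxb, hp, e2, -⟩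
  · have hc : countBelow R.1 y = countBelow as y + countBelow bs y := by
      rw [← countBelow_append]; exact (hp.countP_eq _).symm
    simp only [e2, hc, countBelow_append, countBelow_cons, hay, hy, if_true]; omega
  · have hxy : x < y := by omega
    simp only [e2, hp, countBelow_append, countBelow_cons, hay, hxy, if_true]

/-! ### Nests and the Schensted theorem for the first row. -/

/-- Two pairs, one of which is strictly nested inside the other. -/
def Nested (x y : ℕ × ℕ) : Prop := (x.1 < y.1 ∧ y.2 < x.2) ∨ (y.1 < x.1 ∧ x.2 < y.2)

theorem Nested.symm {x y : ℕ × ℕ} (h : Nested x y) : Nested y x := Or.symm h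

/-- The set `A` contains `n` pairwise nested pairs. -/
def HasNest (A : Set (ℕ × ℕ)) (n : ℕ) : Prop :=
  ∃ S : Finset (ℕ × ℕ), (S : Set (ℕ × ℕ)) ⊆ A ∧ (S : Set (ℕ × ℕ)).Pairwise Nested ∧ S.card = n

theorem hasNest_zero (A : Set (ℕ × ℕ)) : HasNest A 0 := ⟨∅, by simp, by simp, rfl⟩

/-- The order in which pairs are inserted: `x` may be inserted before `y`. -/
def InsertedBefore (x y : ℕ × ℕ) : Prop := y.2 < x.2 ∨ y.2 = x.2 ∧ y.1 ≤ x.1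

theorem InsertedBefore.snd_le {x y : ℕ × ℕ} (h : InsertedBefore x y) : y.2 ≤ x.2 := by
  rcases h with h | h <;> omega

/-- The last pair `z` has the smallest second entry, so in any nest containing it `z` is innermost
and all other first entries are below `z.1`. -/
theorem hasNest_concat {L : List (ℕ × ℕ)} {z : ℕ × ℕ} (hz : ∀ x ∈ L, InsertedBefore x z)
    (y n : ℕ) :
    HasNest {x | x ∈ L ++ [z] ∧ x.1 < y} n ↔ HasNest {x | x ∈ L ∧ x.1 < y} n ∨
      (z.1 < y ∧ ∃ m, n = m + 1 ∧ HasNest {x | x ∈ L ∧ x.1 < z.1} m) := by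
  constructor
  · rintro ⟨S, hS, hn, rfl⟩
    by_cases hzS : z ∈ S
    · right
      refine ⟨(hS hzS).2, (S.erase z).card, (Finset.card_erase_add_one hzS).symm, S.erase z, ?_,
        hn.mono (by simp), rfl⟩
      intro x hx
      obtain ⟨hxz, hxS⟩ := Finset.mem_erase.1 hx
      have hxL : x ∈ L := by
        have := (hS hxS).1
        simpa [hxz] using this
      refine ⟨hxL, ?_⟩
      have h1 := hn hxS hzS hxz
      have h2 := (hz x hxL).snd_le
      rcases h1 with h1 | h1
      · exact h1.1
      · omega
    · left
      refine ⟨S, fun x hx => ?_, hn, rfl⟩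
      have hxz : x ≠ z := fun h => hzS (h ▸ hx)
      have := hS hx
      exact ⟨by simpa [hxz] using this.1, this.2⟩
  · rintro (⟨S, hS, hn, rfl⟩ | ⟨hzy, m, rfl, S, hS, hn, rfl⟩)
    · exact ⟨S, fun x hx => ⟨by simp [(hS hx).1], (hS hx).2⟩, hn, rfl⟩
    · have hzS : z ∉ S := fun h => lt_irrefl _ (hS h).2
      refine ⟨insert z S, ?_, ?_, Finset.card_insert_of_notMem hzS⟩
      · intro x hx
        rcases Finset.mem_insert.1 hx with rfl | hx
        · exact ⟨by simp, hzy⟩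
        · exact ⟨by simp [(hS hx).1], (hS hx).2.trans hzy⟩
      · rw [Finset.coe_insert]
        have key : ∀ x ∈ S, Nested x z := fun x hx => by
          have h1 := hz x (hS hx).1
          have h2 : x.1 < z.1 := (hS hx).2
          -- Ties in the second entry are inserted with decreasing first entry, which rules them out
          -- when `x.1 < z.1`.
          rcases h1 with h1 | h1
          · exact Or.inl ⟨h2, h1⟩
          · omega
        exact hn.insert fun x hx _ => ⟨(key x hx).symm, key x hx⟩

/-- The first row of the bitableau obtained by inserting the pairs of `L` successively. -/
def headRow (L : List (ℕ × ℕ)) : List ℕ × List ℕ :=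
  L.foldl (fun R x => rowStep x.2 x.1 R) ([], [])

theorem headRow_concat (L : List (ℕ × ℕ)) (z : ℕ × ℕ) :
    headRow (L ++ [z]) = rowStep z.2 z.1 (headRow L) := by
  simp [headRow, List.foldl_append]

theorem headRow_pairwise (L : List (ℕ × ℕ)) (hL : ∀ x ∈ L, x.1 < x.2) :
    (headRow L).1.Pairwise (· < ·) := by
  induction L using List.reverseRecOn with
  | nil => simp [headRow]
  | append_singleton L z ih =>
    rw [headRow_concat]
    exact rowStep_pairwise (ih fun x hx => hL x (by simp [hx])) (hL z (by simp))

theorem le_countBelow_headRow_iff_of_le (L : List (ℕ × ℕ)) (hL : ∀ x ∈ L, x.1 < x.2)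
    (hs : L.Pairwise InsertedBefore) (y : ℕ) (hy : ∀ x ∈ L, y ≤ x.2) (n : ℕ) :
    n ≤ countBelow (headRow L).1 y ↔ HasNest {x | x ∈ L ∧ x.1 < y} n := by
  induction L using List.reverseRecOn generalizing y n with
  | nil =>
    simp only [headRow, List.foldl_nil, countBelow, List.countP_nil, Nat.le_zero]
    constructor
    · rintro rfl; exact hasNest_zero _
    · rintro ⟨S, hS, -, rfl⟩
      rw [Finset.card_eq_zero, Finset.eq_empty_iff_forall_notMem]
      intro x hx
      simpa using (hS hx).1
  | append_singleton L z ih =>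
    obtain ⟨hs1, -, hs2⟩ := List.pairwise_append.1 hs
    have hz : ∀ x ∈ L, InsertedBefore x z := fun x hx => hs2 x hx z (by simp)
    have hL' : ∀ x ∈ L, x.1 < x.2 := fun x hx => hL x (by simp [hx])
    have hzz := hL z (by simp)
    have ih' := ih hL' hs1
    have i1 := ih' y (fun x hx => hy x (by simp [hx]))
    -- The threshold must vary in the induction: the recurrence also looks at `z.1`, which is
    -- admissible because `z.1 < z.2 ≤ x.2`.
    have i2 := ih' z.1 (fun x hx => hzz.le.trans (hz x hx).snd_le)
    rw [hasNest_concat hz, headRow_concat,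
      countBelow_rowStep_of_le (headRow_pairwise L hL') hzz (hy z (by simp)), ← i1]
    simp only [← i2]
    split_ifs with h
    · rw [le_max_iff]
      rcases n with _ | m
      · simp
      · refine or_congr Iff.rfl ⟨fun hm => ⟨h, m, rfl, by omega⟩, fun ⟨_, m', e, hm⟩ => by omega⟩
    · simp [h]

theorem mem_headRow_snd (L : List (ℕ × ℕ)) (hL : ∀ x ∈ L, x.1 < x.2) :
    ∀ y ∈ (headRow L).2, ∃ x ∈ L, x.2 = y := by
  induction L using List.reverseRecOn with
  | nil => simp [headRow]
  | append_singleton L z ih =>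
    have hL' : ∀ x ∈ L, x.1 < x.2 := fun x hx => hL x (by simp [hx])
    rw [headRow_concat]
    intro y hy
    have hy' : y = z.2 ∨ y ∈ (headRow L).2 := by
      obtain ⟨_, _, -, -, h⟩ := rowStep_spec (headRow_pairwise L hL') (hL z (by simp))
      rcases h with ⟨-, -, e, -⟩ | ⟨_, -, -, -, e, -⟩ <;> rw [e] at hy
      · simpa using hy
      · exact Or.inr hy
    rcases hy' with rfl | hy
    · exact ⟨z, by simp, rfl⟩
    · obtain ⟨x, hx, rfl⟩ := ih hL' y hy
      exact ⟨x, by simp [hx], rfl⟩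

theorem add_countBelow_le_headRow_iff_of_le (L : List (ℕ × ℕ)) (hL : ∀ x ∈ L, x.1 < x.2)
    (hs : L.Pairwise InsertedBefore) (k : ℕ) (hk : ∀ x ∈ L, k ≤ x.2) (n : ℕ) :
    n + countBelow (headRow L).2 k ≤ countBelow (headRow L).1 k ↔
      HasNest {x | x ∈ L ∧ x.1 < k ∧ k ≤ x.2} n := by
  have e : countBelow (headRow L).2 k = 0 := countBelow_eq_zero fun y hy => by
    obtain ⟨x, hx, rfl⟩ := mem_headRow_snd L hL y hy
    exact hk x hx
  rw [e, add_zero, le_countBelow_headRow_iff_of_le L hL hs k hk n]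
  have : {x | x ∈ L ∧ x.1 < k ∧ k ≤ x.2} = {x | x ∈ L ∧ x.1 < k} := by
    ext x
    exact ⟨fun h => ⟨h.1, h.2.1⟩, fun h => ⟨h.1, h.2, hk x h.1⟩⟩
  rw [this]

/-- Schensted's theorem for the first row: the excess of entries `< k` of `P` over those of `Q`
is the largest number of pairwise nested pairs `(a, b)` with `a < k ≤ b`. -/
theorem add_countBelow_le_headRow_iff (L : List (ℕ × ℕ)) (hL : ∀ x ∈ L, x.1 < x.2)
    (hs : L.Pairwise InsertedBefore) (k n : ℕ) :
    n + countBelow (headRow L).2 k ≤ countBelow (headRow L).1 k ↔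
      HasNest {x | x ∈ L ∧ x.1 < k ∧ k ≤ x.2} n := by
  induction L using List.reverseRecOn with
  | nil => exact add_countBelow_le_headRow_iff_of_le [] hL hs k (by simp) n
  | append_singleton L z ih =>
    -- Second entries decrease along the list, so the thresholds split it: while all are `≥ k`, `Q`
    -- has nothing below `k`; afterwards no new pair straddles `k` and the excess is constant.
    by_cases hk : ∀ x ∈ L ++ [z], k ≤ x.2
    · exact add_countBelow_le_headRow_iff_of_le _ hL hs k hk n
    · obtain ⟨hs1, -, hs2⟩ := List.pairwise_append.1 hs
      have hL' : ∀ x ∈ L, x.1 < x.2 := fun x hx => hL x (by simp [hx])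
      have hzk : z.2 < k := by
        push Not at hk
        obtain ⟨x, hx, hxk⟩ := hk
        rcases List.mem_append.1 hx with hx | hx
        · exact (hs2 x hx z (by simp)).snd_le.trans_lt hxk
        · rw [List.mem_singleton.1 hx] at hxk; exact hxk
      have e : {x | x ∈ L ++ [z] ∧ x.1 < k ∧ k ≤ x.2} = {x | x ∈ L ∧ x.1 < k ∧ k ≤ x.2} := by
        ext x
        simp only [List.mem_append, List.mem_singleton, Set.mem_ofPred_eq]
        constructor
        · rintro ⟨h | rfl, h2, h3⟩
          · exact ⟨h, h2, h3⟩
          · omega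
        · rintro ⟨h, h2⟩; exact ⟨Or.inl h, h2⟩
      have step := countBelow_rowStep_of_lt (headRow_pairwise L hL') (hL z (by simp)) hzk
      rw [e, headRow_concat]
      rw [← ih hL' hs1]
      omega

/-! ### The whole bitableau: contents and number of rows. -/

/-- The notched bitableau obtained by inserting the pairs of `L` successively. -/
def insertAll (L : List (ℕ × ℕ)) : NotchedBitableau :=
  L.foldl (fun T x => boundedInsert x.2 x.1 T) []

theorem insertAll_concat (L : List (ℕ × ℕ)) (z : ℕ × ℕ) :
    insertAll (L ++ [z]) = boundedInsert z.2 z.1 (insertAll L) := by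
  simp [insertAll, List.foldl_append]

theorem headD_insertAll (L : List (ℕ × ℕ)) : (insertAll L).headD ([], []) = headRow L := by
  induction L using List.reverseRecOn with
  | nil => rfl
  | append_singleton L z ih => rw [insertAll_concat, headD_boundedInsert, ih, headRow_concat]

theorem boundedInsert_cons_of_none {b a : ℕ} {R : List ℕ × List ℕ} (T : NotchedBitableau)
    (h : R.1.find? (fun x => decide (a ≤ x ∧ x < b)) = none) :
    boundedInsert b a (R :: T) = rowStep b a R :: T := by
  simp only [boundedInsert, rowStep, h]

theorem boundedInsert_cons_of_some {b a x : ℕ} {R : List ℕ × List ℕ} (T : NotchedBitableau)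
    (h : R.1.find? (fun x => decide (a ≤ x ∧ x < b)) = some x) :
    boundedInsert b a (R :: T) = rowStep b a R :: boundedInsert b x T := by
  simp only [boundedInsert, rowStep, h]

theorem cons_replace_perm {x : ℕ} (a : ℕ) {p : List ℕ} (hx : x ∈ p) :
    (x :: p.replace x a).Perm (a :: p) := by
  obtain ⟨as, bs, rfl, has⟩ := List.eq_append_cons_of_mem hx
  rw [List.replace_append, if_neg has, List.replace_cons_self]
  refine (List.Perm.cons x List.perm_middle).trans ((List.Perm.swap a x _).trans ?_)
  exact List.Perm.cons a List.perm_middle.symm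

theorem flatMap_fst_boundedInsert (b a : ℕ) (T : NotchedBitableau) :
    ((boundedInsert b a T).flatMap Prod.fst).Perm (a :: T.flatMap Prod.fst) := by
  induction T generalizing a with
  | nil => simp [boundedInsert]
  | cons R T ih =>
    cases h : R.1.find? (fun x => decide (a ≤ x ∧ x < b)) with
    | none =>
      rw [boundedInsert_cons_of_none T h]
      simp only [rowStep, h, List.flatMap_cons]
      rw [← List.cons_append]
      exact (List.perm_middle.trans ((filter_lt_append_filter_le_perm b R.1).cons a)).append_right _
    | some x =>
      rw [boundedInsert_cons_of_some T h]
      simp only [rowStep, h, List.flatMap_cons]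
      refine ((ih x).append_left _).trans (List.perm_middle.trans ?_)
      rw [← List.cons_append, ← List.cons_append]
      exact (cons_replace_perm a (List.mem_of_find?_eq_some h)).append_right _

theorem flatMap_snd_boundedInsert (b a : ℕ) (T : NotchedBitableau) :
    ((boundedInsert b a T).flatMap Prod.snd).Perm (b :: T.flatMap Prod.snd) := by
  induction T generalizing a with
  | nil => simp [boundedInsert]
  | cons R T ih =>
    cases h : R.1.find? (fun x => decide (a ≤ x ∧ x < b)) with
    | none =>
      rw [boundedInsert_cons_of_none T h]
      simp only [rowStep, h, List.flatMap_cons, List.cons_append]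
      exact List.Perm.refl _
    | some x =>
      rw [boundedInsert_cons_of_some T h]
      simp only [rowStep, h, List.flatMap_cons]
      exact ((ih x).append_left _).trans List.perm_middle

theorem flatMap_fst_insertAll (L : List (ℕ × ℕ)) :
    ((insertAll L).flatMap Prod.fst).Perm (L.map Prod.fst) := by
  induction L using List.reverseRecOn with
  | nil => simp [insertAll]
  | append_singleton L z ih =>
    rw [insertAll_concat, List.map_append]
    exact (flatMap_fst_boundedInsert _ _ _).trans
      ((ih.cons _).trans (List.perm_append_singleton _ _).symm)

theorem flatMap_snd_insertAll (L : List (ℕ × ℕ)) :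
    ((insertAll L).flatMap Prod.snd).Perm (L.map Prod.snd) := by
  induction L using List.reverseRecOn with
  | nil => simp [insertAll]
  | append_singleton L z ih =>
    rw [insertAll_concat, List.map_append]
    exact (flatMap_snd_boundedInsert _ _ _).trans
      ((ih.cons _).trans (List.perm_append_singleton _ _).symm)

theorem mem_rowStep_fst {b a y : ℕ} {R : List ℕ × List ℕ} (hy : y ∈ (rowStep b a R).1) :
    y = a ∨ y ∈ R.1 := by
  cases h : R.1.find? (fun x => decide (a ≤ x ∧ x < b)) with
  | none =>
    simp only [rowStep, h, List.mem_append, List.mem_cons, List.mem_filter] at hy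
    tauto
  | some x =>
    simp only [rowStep, h] at hy
    have := (cons_replace_perm a (List.mem_of_find?_eq_some h)).subset
      (List.mem_cons_of_mem _ hy)
    simpa using this

/-- If no three inserted pairs are pairwise weakly comparable and cross, then there are at most two
rows. -/
theorem length_insertAll_le_two (L : List (ℕ × ℕ)) (hL : ∀ x ∈ L, x.1 < x.2)
    (hno : ∀ u v w : ℕ × ℕ, [u, v, w].Sublist L → w.1 ≤ v.1 → v.1 ≤ u.1 → ¬ u.1 < w.2) :
    (insertAll L).length ≤ 2 ∧
      -- Invariant carried by the induction: an entry `y` of the second row lying weakly above an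
      -- entry `x` of the first is witnessed by two successively inserted pairs with first entries
      -- `y` and some value in `[x, y]`.
      ∀ R R' T, insertAll L = R :: R' :: T → ∀ y ∈ R'.1, ∀ x ∈ R.1, x ≤ y →
        ∃ u v : ℕ × ℕ, [u, v].Sublist L ∧ u.1 = y ∧ v.1 ≤ y ∧ x ≤ v.1 := by
  induction L using List.reverseRecOn with
  | nil => simp [insertAll]
  | append_singleton L z ih =>
    have hL' : ∀ x ∈ L, x.1 < x.2 := fun x hx => hL x (by simp [hx])
    have hz := hL z (by simp)
    obtain ⟨ih1, ih2⟩ := ih hL' fun u v w h =>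
      hno u v w (h.trans (List.sublist_append_left _ _))
    have hcont := flatMap_fst_insertAll L
    have hpw := headRow_pairwise L hL'
    rw [← headD_insertAll] at hpw
    rw [insertAll_concat]
    have old : ∀ {u v : ℕ × ℕ}, [u, v].Sublist L → [u, v].Sublist (L ++ [z]) := fun h =>
      h.trans (List.sublist_append_left _ _)
    have new : ∀ {y : ℕ}, y ∈ (insertAll L).flatMap Prod.fst →
        ∃ u : ℕ × ℕ, [u, z].Sublist (L ++ [z]) ∧ u.1 = y := fun {y} hy => by
      obtain ⟨u, hu, rfl⟩ := List.mem_map.1 (hcont.subset hy)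
      exact ⟨u, (List.singleton_sublist.2 hu).append (List.Sublist.refl [z]), rfl⟩
    match hT : insertAll L with
    | [] => simp [boundedInsert]
    | R :: T =>
      rw [hT] at ih1 ih2 hpw new
      simp only [List.headD_cons] at hpw
      cases h : R.1.find? (fun x => decide (z.1 ≤ x ∧ x < z.2)) with
      | none =>
        rw [boundedInsert_cons_of_none T h]
        refine ⟨by simpa using ih1, ?_⟩
        rintro _ R' T' e y hy x hx hxy
        obtain ⟨rfl, rfl⟩ := List.cons.inj e
        rcases mem_rowStep_fst hx with rfl | hx
        · obtain ⟨u, hu, rfl⟩ := new (y := y) (by simp [hy])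
          exact ⟨u, z, hu, rfl, hxy, le_rfl⟩
        · obtain ⟨u, v, huv, h'⟩ := ih2 R R' T' rfl y hy x hx hxy
          exact ⟨u, v, old huv, h'⟩
      | some c =>
        have hc := List.find?_some h
        simp only [decide_eq_true_eq] at hc
        have hcR := List.mem_of_find?_eq_some h
        rw [boundedInsert_cons_of_some T h]
        -- The pair that brought in `c`, followed by `z`, is the witness for `c`: after the
        -- replacement, every first-row entry `≤ c` is `≤ z.1`.
        have bumped : ∀ x ∈ (rowStep z.2 z.1 R).1, x ≤ c → ∃ u v : ℕ × ℕ,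
            [u, v].Sublist (L ++ [z]) ∧ u.1 = c ∧ v.1 ≤ c ∧ x ≤ v.1 := by
          intro x hx hxc
          obtain ⟨u, hu, rfl⟩ := new (y := c) (by simp [hcR])
          refine ⟨u, z, hu, rfl, hc.1, ?_⟩
          obtain ⟨as, bs, e, hp, h'⟩ := rowStep_spec hpw hz
          rcases h' with ⟨-, -, -, e'⟩ | ⟨x', -, -, e1, -, e2⟩
          · rw [h] at e'; cases e'
          · rw [h] at e2
            obtain rfl := Option.some.inj e2
            rw [e] at hx
            rw [e1] at hpw
            rcases List.mem_append.1 hx with hx | hx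
            · exact ((List.pairwise_append.1 hp).2.2 x hx z.1 (by simp)).le
            · rcases List.mem_cons.1 hx with rfl | hx
              · exact le_rfl
              · have := (List.pairwise_cons.1 (List.pairwise_append.1 hpw).2.1).1 x hx
                omega
        match T, ih1 with
        | [], _ =>
          refine ⟨by simp [boundedInsert], ?_⟩
          rintro _ R' T' e y hy x hx hxy
          simp only [boundedInsert, List.cons.injEq] at e
          obtain ⟨rfl, rfl, rfl⟩ := e
          obtain rfl : y = c := by simpa using hy
          exact bumped x hx hxy
        | [R₂], _ =>
          cases h₂ : R₂.1.find? (fun x => decide (c ≤ x ∧ x < z.2)) with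
          | none =>
            rw [boundedInsert_cons_of_none _ h₂]
            refine ⟨by simp, ?_⟩
            rintro _ R' T' e y hy x hx hxy
            simp only [List.cons.injEq] at e
            obtain ⟨rfl, rfl, rfl⟩ := e
            rcases mem_rowStep_fst hy with rfl | hy
            · exact bumped x hx hxy
            · rcases mem_rowStep_fst hx with rfl | hx
              · obtain ⟨u, hu, rfl⟩ := new (y := y) (by simp [hy])
                exact ⟨u, z, hu, rfl, hxy, le_rfl⟩
              · obtain ⟨u, v, huv, h'⟩ := ih2 R R₂ [] rfl y hy x hx hxy
                exact ⟨u, v, old huv, h'⟩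
          | some y =>
            -- A third row would require `c` to bump some `y < z.2`; the invariant for `c ≤ y` then
            -- supplies `u`, `v` which together with `z` form a forbidden triple.
            exfalso
            have hy := List.find?_some h₂
            simp only [decide_eq_true_eq] at hy
            obtain ⟨u, v, huv, rfl, h3, h4⟩ :=
              ih2 R R₂ [] rfl y (List.mem_of_find?_eq_some h₂) c hcR hy.1
            exact hno u v z (huv.append (List.Sublist.refl [z])) (hc.1.trans h4) h3 hy.2

/-! ### Unions of two nests, and the insertion order. -/

theorem List.Pairwise.of_subperm_pair {α : Type*} {r : α → α → Prop}
    (hr : ∀ x y, r x y → r y x) {l : List α} (hl : l.Pairwise r) {x y : α} (h : [x, y].Subperm l) : r x y := by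
  obtain ⟨l', hp, hs⟩ := h
  simpa using (hl.sublist hs).perm hp fun {a b} => hr a b

/-- Two pairs comparable in the product order are not strictly nested. -/
theorem not_nested_of_comparable {x y : ℕ × ℕ} (h : x ≤ y ∨ y ≤ x) : ¬ Nested x y := by
  rintro (h' | h') <;> rcases h with h | h <;> have h1 := h.1 <;> have h2 := h.2 <;> omega

/-- A union of two nested chains contains no three pairwise comparable pairs. -/
theorem not_comparable_of_le_add {A B : List (ℕ × ℕ)} (hA : A.Pairwise Nested)
    (hB : B.Pairwise Nested) {u v w : ℕ × ℕ}
    (h : (([u, v, w] : List (ℕ × ℕ)) : Multiset (ℕ × ℕ)) ≤ (A : Multiset (ℕ × ℕ)) + B) :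
    ¬ (w ≤ v ∧ v ≤ u) := by
  rintro ⟨hwv, hvu⟩
  have hcomp : [u, v, w].Pairwise fun x y => x ≤ y ∨ y ≤ x := by
    simp [hwv, hvu, hwv.trans hvu]
  set S : Multiset (ℕ × ℕ) := (([u, v, w] : List (ℕ × ℕ)) : Multiset (ℕ × ℕ)) with hS
  -- Comparable pairs are never nested, so the triple and a nest share at most one element, counted
  -- with multiplicity. The triple splits into `S ∩ A` and `S - A ≤ B`, of total size three.
  have key : ∀ (D : List (ℕ × ℕ)) (W : Multiset (ℕ × ℕ)), D.Pairwise Nested → W ≤ S →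
      W ≤ (D : Multiset (ℕ × ℕ)) → W.card ≤ 1 := by
    intro D W hD hWS hWD
    by_contra hc
    push Not at hc
    induction W using Quot.inductionOn with | _ l =>
    match l, hc with
    | x :: y :: t, _ =>
      have hsub : [x, y].Subperm (x :: y :: t) :=
        (List.Sublist.subperm (by simp))
      exact not_nested_of_comparable
        (hcomp.of_subperm_pair (fun _ _ => Or.symm) (hsub.trans (Multiset.coe_le.1 hWS)))
        (hD.of_subperm_pair (fun _ _ => Nested.symm) (hsub.trans (Multiset.coe_le.1 hWD)))
  have h1 := key A (S ∩ A) hA Multiset.inter_le_left Multiset.inter_le_right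
  have h2 := key B (S - A) hB tsub_le_self (tsub_le_iff_left.2 h)
  have h3 := congrArg Multiset.card (Multiset.sub_add_inter S A)
  rw [Multiset.card_add] at h3
  have h4 : S.card = 3 := rfl
  omega

theorem coe_lexList (U : Multiset (ℕ × ℕ)) : (lexList U : Multiset (ℕ × ℕ)) = U := by
  rw [lexList, ← Multiset.map_coe, Multiset.sort_eq, Multiset.map_map]
  exact Multiset.map_id U

theorem lexList_pairwise (U : Multiset (ℕ × ℕ)) : (lexList U).Pairwise InsertedBefore := by
  refine List.pairwise_map.2 ((Multiset.pairwise_sort _ _).imp fun {x y} h => ?_)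
  rcases Prod.Lex.le_iff.1 h with h | h
  · exact Or.inl h
  · exact Or.inr h

theorem mem_lexList {U : Multiset (ℕ × ℕ)} {x : ℕ × ℕ} : x ∈ lexList U ↔ x ∈ U := by
  rw [← Multiset.mem_coe, coe_lexList]

/-! ### Reflection symmetry of the first row. -/

/-- The reflection `(a, b) ↦ (b^*, a^*)` of pairs. -/
def hashPair (d : ℕ) (x : ℕ × ℕ) : ℕ × ℕ := (starIndex d x.2, starIndex d x.1)

theorem hashMultiset_eq_map (d : ℕ) (U : Multiset (ℕ × ℕ)) :
    hashMultiset d U = U.map (hashPair d) := rfl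

/-- Both entries of the pair `x` lie in `{1, …, 2d}`. -/
def InRange (d : ℕ) (x : ℕ × ℕ) : Prop :=
  x.1 ∈ Finset.Icc 1 (2 * d) ∧ x.2 ∈ Finset.Icc 1 (2 * d)

theorem starIndex_mem {d j : ℕ} (hj : j ∈ Finset.Icc 1 (2 * d)) :
    starIndex d j ∈ Finset.Icc 1 (2 * d) := by
  rw [Finset.mem_Icc, starIndex] at *; omega

theorem starIndex_starIndex {d j : ℕ} (hj : j ∈ Finset.Icc 1 (2 * d)) :
    starIndex d (starIndex d j) = j := by
  rw [Finset.mem_Icc] at hj; simp only [starIndex]; omega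

theorem starIndex_lt_iff {d i j : ℕ} (hi : i ∈ Finset.Icc 1 (2 * d))
    (hj : j ∈ Finset.Icc 1 (2 * d)) : starIndex d i < starIndex d j ↔ j < i := by
  rw [Finset.mem_Icc] at *; simp only [starIndex]; omega

theorem InRange.hashPair {d : ℕ} {x : ℕ × ℕ} (h : InRange d x) : InRange d (hashPair d x) :=
  ⟨starIndex_mem h.2, starIndex_mem h.1⟩

theorem hashPair_hashPair {d : ℕ} {x : ℕ × ℕ} (h : InRange d x) :
    hashPair d (hashPair d x) = x :=
  Prod.ext (starIndex_starIndex h.1) (starIndex_starIndex h.2)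

theorem Nested.hashPair {d : ℕ} {x y : ℕ × ℕ} (hx : InRange d x) (hy : InRange d y)
    (h : Nested x y) : Nested (hashPair d x) (hashPair d y) := by
  simp only [Nested, _root_.hashPair, starIndex_lt_iff hx.1 hy.1, starIndex_lt_iff hx.2 hy.2,
    starIndex_lt_iff hy.1 hx.1, starIndex_lt_iff hy.2 hx.2]
  rcases h with h | h <;> tauto

/-- Reflection turns nests straddling `k` into nests straddling `2d + 2 - k`. -/
theorem HasNest.reflect {d : ℕ} {U : Multiset (ℕ × ℕ)} (hU : ∀ x ∈ U, InRange d x)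
    (hsym : U.map (hashPair d) = U) {k n : ℕ}
    (h : HasNest {x | x ∈ U ∧ x.1 < k ∧ k ≤ x.2} n) :
    HasNest {x | x ∈ U ∧ x.1 < 2 * d + 2 - k ∧ 2 * d + 2 - k ≤ x.2} n := by
  obtain ⟨S, hS, hn, rfl⟩ := h
  have hr : ∀ x ∈ S, InRange d x := fun x hx => hU x (hS hx).1
  refine ⟨S.image (hashPair d), ?_, ?_, Finset.card_image_of_injOn fun x hx y hy e => ?_⟩
  · intro y hy
    obtain ⟨x, hx, rfl⟩ := Finset.mem_image.1 hy
    obtain ⟨h1, h2, h3⟩ := hS hx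
    obtain ⟨r1, r2⟩ := hr x hx
    refine ⟨hsym ▸ Multiset.mem_map_of_mem _ h1, ?_⟩
    rw [Finset.mem_Icc] at r1 r2
    -- `k ≤ b` is equivalent to `b^* < 2d + 2 - k`, and `a < k` to `2d + 2 - k ≤ a^*`.
    simp only [hashPair, starIndex]
    omega
  · intro y hy z hz hyz
    obtain ⟨x, hx, rfl⟩ := Finset.mem_image.1 hy
    obtain ⟨w, hw, rfl⟩ := Finset.mem_image.1 hz
    exact (hn hx hw fun e => hyz (by rw [e])).hashPair (hr x hx) (hr w hw)
  · rw [← hashPair_hashPair (hr x hx), e, hashPair_hashPair (hr y hy)]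

/-- In the first row of the bitableau of a reflection-invariant multiset, `j` and `j^*` together
occur as often in `P` as in `Q`. -/
theorem count_headRow_add {d : ℕ} {U : Multiset (ℕ × ℕ)} (hU : ∀ x ∈ U, InRange d x)
    (hlt : ∀ x ∈ U, x.1 < x.2) (hsym : U.map (hashPair d) = U) {j : ℕ}
    (hj : j ∈ Finset.Icc 1 (2 * d)) :
    (headRow (lexList U)).1.count j + (headRow (lexList U)).1.count (starIndex d j) =
      (headRow (lexList U)).2.count j + (headRow (lexList U)).2.count (starIndex d j) := by
  set R := headRow (lexList U) with hR
  have key : ∀ k n, n + countBelow R.2 k ≤ countBelow R.1 k ↔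
      HasNest {x | x ∈ U ∧ x.1 < k ∧ k ≤ x.2} n := fun k n => by
    rw [hR, add_countBelow_le_headRow_iff _ (fun x hx => hlt x (mem_lexList.1 hx))
      (lexList_pairwise U)]
    simp only [mem_lexList]
  have refl : ∀ k ≤ 2 * d + 2, countBelow R.1 k + countBelow R.2 (2 * d + 2 - k) =
      countBelow R.1 (2 * d + 2 - k) + countBelow R.2 k := fun k hk => by
    have h1 : ∀ n, n + countBelow R.2 k ≤ countBelow R.1 k ↔
        n + countBelow R.2 (2 * d + 2 - k) ≤ countBelow R.1 (2 * d + 2 - k) := fun n => by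
      rw [key, key]
      refine ⟨HasNest.reflect hU hsym, fun h => ?_⟩
      have := h.reflect hU hsym
      rwa [Nat.sub_sub_self hk] at this
    have h2 := (key k 0).2 (hasNest_zero _)
    have h3 := (key (2 * d + 2 - k) 0).2 (hasNest_zero _)
    -- The equivalence is tested at each of the two excesses, which are nonnegative by `h2` and
    -- `h3`; hence they coincide.
    have h4 := (h1 (countBelow R.1 k - countBelow R.2 k)).1 (by omega)
    have h5 := (h1 (countBelow R.1 (2 * d + 2 - k) - countBelow R.2 (2 * d + 2 - k))).2 (by omega)
    omega
  rw [Finset.mem_Icc] at hj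
  -- Thresholds `j` and `j + 1` reflect to `j^* + 1` and `j^*`, so subtracting the two symmetries
  -- isolates the multiplicities of `j` and `j^*`.
  have e1 := refl j (by omega)
  have e2 := refl (j + 1) (by omega)
  rw [show 2 * d + 2 - j = starIndex d j + 1 by simp only [starIndex]; omega] at e1
  rw [show 2 * d + 2 - (j + 1) = starIndex d j by simp only [starIndex]; omega] at e2
  simp only [countBelow_succ] at e1 e2
  omega

/-! ### Reflexive rows. -/

/-- The set `β` contains exactly one of `j`, `j^*` for every `j`. -/
def IsSelfDual (d : ℕ) (β : Finset ℕ) : Prop :=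
  ∀ j ∈ Finset.Icc 1 (2 * d), starIndex d j ∈ β ↔ j ∉ β

/-- In the row `(R, S)`, the entries of `R` are the `j^*` for `j` in `S`; moreover `R` is disjoint
from `β` and `S` is contained in it. -/
def IsReflexiveRow (d : ℕ) (β : Finset ℕ) (R : List ℕ × List ℕ) : Prop :=
  (∀ j ∈ R.1, j ∈ Finset.Icc 1 (2 * d) ∧ j ∉ β) ∧ (∀ j ∈ R.2, j ∈ Finset.Icc 1 (2 * d) ∧ j ∈ β) ∧
    ∀ j ∈ Finset.Icc 1 (2 * d), j ∈ R.1 ↔ starIndex d j ∈ R.2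

theorem isReflexiveRow_nil (d : ℕ) (β : Finset ℕ) : IsReflexiveRow d β ([], []) := by
  simp [IsReflexiveRow]

theorem isReflexiveRow_of_count {d : ℕ} {β : Finset ℕ} {R : List ℕ × List ℕ}
    (h1 : ∀ j ∈ R.1, j ∈ Finset.Icc 1 (2 * d) ∧ j ∉ β)
    (h2 : ∀ j ∈ R.2, j ∈ Finset.Icc 1 (2 * d) ∧ j ∈ β)
    (h : ∀ j ∈ Finset.Icc 1 (2 * d), j ∉ β → R.1.count j = R.2.count (starIndex d j))
    (hβ : IsSelfDual d β) : IsReflexiveRow d β R := by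
  refine ⟨h1, h2, fun j hj => ?_⟩
  by_cases hjβ : j ∈ β
  · refine iff_of_false (fun hm => (h1 j hm).2 hjβ) fun hm => ?_
    exact (hβ j hj).1 (h2 _ hm).2 hjβ
  · rw [← List.count_pos_iff, h j hj hjβ, List.count_pos_iff]

/-- For a reflection-invariant union of two chains, the first and the last row of the bitableau
are reflexive. -/
theorem isReflexiveRow_brskNeg {d : ℕ} {β : Finset ℕ} (hβ : IsSelfDual d β)
    {U : Multiset (ℕ × ℕ)} (hU : ∀ x ∈ U, InRange d x) (hlt : ∀ x ∈ U, x.1 < x.2)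
    (hUβ : ∀ x ∈ U, x.1 ∉ β ∧ x.2 ∈ β) (hsym : U.map (hashPair d) = U)
    {A B : List (ℕ × ℕ)} (hA : A.Pairwise Nested) (hB : B.Pairwise Nested)
    (hAB : U ≤ (A : Multiset (ℕ × ℕ)) + B) :
    IsReflexiveRow d β ((brskNeg U).headD ([], [])) ∧
      IsReflexiveRow d β ((brskNeg U).getLastD ([], [])) := by
  have eT : brskNeg U = insertAll (lexList U) := rfl
  have hhead := headD_insertAll (lexList U)
  have hP := flatMap_fst_insertAll (lexList U)
  have hQ := flatMap_snd_insertAll (lexList U)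
  have hlen := (length_insertAll_le_two (lexList U) (fun x hx => hlt x (mem_lexList.1 hx))
    (fun u v w hs h1 h2 _ => by
      have hle : (([u, v, w] : List (ℕ × ℕ)) : Multiset (ℕ × ℕ)) ≤ (A : Multiset (ℕ × ℕ)) + B :=
        (Multiset.coe_le.2 hs.subperm).trans (by rwa [coe_lexList])
      have hp := (lexList_pairwise U).sublist hs
      simp only [List.pairwise_cons, List.mem_cons, List.not_mem_nil, or_false] at hp
      exact not_comparable_of_le_add hA hB hle
        ⟨⟨h1, (hp.2.1 w rfl).snd_le⟩, ⟨h2, (hp.1 v (Or.inl rfl)).snd_le⟩⟩)).1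
  rw [eT]
  have memP : ∀ R ∈ insertAll (lexList U), ∀ j ∈ R.1, j ∈ Finset.Icc 1 (2 * d) ∧ j ∉ β := by
    intro R hR j hj
    obtain ⟨x, hx, rfl⟩ := List.mem_map.1 (hP.subset (List.mem_flatMap.2 ⟨R, hR, hj⟩))
    exact ⟨(hU x (mem_lexList.1 hx)).1, (hUβ x (mem_lexList.1 hx)).1⟩
  have memQ : ∀ R ∈ insertAll (lexList U), ∀ j ∈ R.2, j ∈ Finset.Icc 1 (2 * d) ∧ j ∈ β := by
    intro R hR j hj
    obtain ⟨x, hx, rfl⟩ := List.mem_map.1 (hQ.subset (List.mem_flatMap.2 ⟨R, hR, hj⟩))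
    exact ⟨(hU x (mem_lexList.1 hx)).2, (hUβ x (mem_lexList.1 hx)).2⟩
  have total : ∀ j ∈ Finset.Icc 1 (2 * d),
      ((insertAll (lexList U)).flatMap Prod.fst).count j =
        ((insertAll (lexList U)).flatMap Prod.snd).count (starIndex d j) := by
    intro j hj
    rw [hP.count_eq, hQ.count_eq, ← Multiset.coe_count, ← Multiset.coe_count,
      ← Multiset.map_coe, ← Multiset.map_coe, coe_lexList]
    conv_lhs => rw [← hsym]
    rw [Multiset.map_map, Multiset.count_map, Multiset.count_map]
    congr 1
    refine Multiset.filter_congr fun x hx => ?_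
    simp only [Function.comp, hashPair]
    constructor
    · rintro rfl; exact starIndex_starIndex (hU x hx).2
    · intro e; rw [← e, starIndex_starIndex hj]
  match hT : insertAll (lexList U), hlen with
  | [], _ => exact ⟨isReflexiveRow_nil d β, isReflexiveRow_nil d β⟩
  | [R], _ =>
    rw [hT] at memP memQ total
    have := isReflexiveRow_of_count (memP R (by simp)) (memQ R (by simp))
      (fun j hj _ => by simpa using total j hj) hβ
    exact ⟨this, this⟩
  | [R, R'], _ =>
    rw [hT] at memP memQ total hhead
    simp only [List.headD_cons] at hhead
    have c1 : ∀ j ∈ Finset.Icc 1 (2 * d), j ∉ β → R.1.count j = R.2.count (starIndex d j) := by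
      intro j hj hjβ
      -- Of the four multiplicities, two vanish because `P` avoids `β` and `Q` lies in `β`.
      have h := count_headRow_add hU hlt hsym hj
      rw [← hhead] at h
      have h1 : R.1.count (starIndex d j) = 0 := List.count_eq_zero.2 fun hm =>
        (memP R (by simp) _ hm).2 ((hβ j hj).2 hjβ)
      have h2 : R.2.count j = 0 := List.count_eq_zero.2 fun hm => hjβ (memQ R (by simp) _ hm).2
      omega
    refine ⟨isReflexiveRow_of_count (memP R (by simp)) (memQ R (by simp)) c1 hβ,
      isReflexiveRow_of_count (memP R' (by simp)) (memQ R' (by simp)) (fun j hj hjβ => ?_) hβ⟩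
    have h1 := total j hj
    have h2 := c1 j hj hjβ
    simp only [List.flatMap_cons, List.flatMap_nil, List.append_nil, List.count_append] at h1
    change R'.1.count j = R'.2.count (starIndex d j)
    omega

/-- The two nests are `C` and its reflection. Reflection preserves the condition `a < b`, so the
negative part inherits the symmetry. -/
theorem isReflexiveRow_brskNeg_negativePart {d : ℕ} {β : Finset ℕ} (hβ : IsSelfDual d β)
    {C : List (ℕ × ℕ)} (hC : C.Pairwise Nested) (hr : ∀ x ∈ C, InRange d x)
    (hCβ : ∀ x ∈ C, x.1 ∉ β ∧ x.2 ∈ β) :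
    IsReflexiveRow d β ((brskNeg (negativePart
        ((C : Multiset (ℕ × ℕ)) + hashMultiset d C))).headD ([], [])) ∧
      IsReflexiveRow d β ((brskNeg (negativePart
        ((C : Multiset (ℕ × ℕ)) + hashMultiset d C))).getLastD ([], [])) := by
  set V : Multiset (ℕ × ℕ) := (C : Multiset (ℕ × ℕ)) + hashMultiset d C with hV
  have hmem : ∀ x ∈ V, x ∈ C ∨ ∃ y ∈ C, hashPair d y = x := by
    intro x hx
    simpa [hV, hashMultiset_eq_map] using hx
  have hVr : ∀ x ∈ V, InRange d x := by
    intro x hx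
    rcases hmem x hx with h | ⟨y, hy, rfl⟩
    · exact hr x h
    · exact (hr y hy).hashPair
  have hVβ : ∀ x ∈ V, x.1 ∉ β ∧ x.2 ∈ β := by
    intro x hx
    rcases hmem x hx with h | ⟨y, hy, rfl⟩
    · exact hCβ x h
    · refine ⟨fun h => (hβ _ (hr y hy).2).1 h (hCβ y hy).2, (hβ _ (hr y hy).1).2 (hCβ y hy).1⟩
  have hVsym : V.map (hashPair d) = V := by
    rw [hV, hashMultiset_eq_map, Multiset.map_add, Multiset.map_map, add_comm]
    congr 1
    conv_rhs => rw [← Multiset.map_id (C : Multiset (ℕ × ℕ))]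
    exact Multiset.map_congr rfl fun x hx => hashPair_hashPair (hr x hx)
  refine isReflexiveRow_brskNeg hβ (fun x hx => hVr x (Multiset.mem_of_mem_filter hx))
    (fun x hx => (Multiset.mem_filter.1 hx).2) (fun x hx => hVβ x (Multiset.mem_of_mem_filter hx))
    ?_ hC (B := C.map (hashPair d)) ?_ (Multiset.filter_le _ _)
  · conv_rhs => rw [negativePart, ← hVsym, Multiset.filter_map]
    rw [negativePart]
    congr 1
    exact Multiset.filter_congr fun x hx => (starIndex_lt_iff (hVr x hx).2 (hVr x hx).1).symm
  · refine List.pairwise_map.2 (hC.imp_of_mem fun hx hy h => ?_)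
    exact h.hashPair (hr _ hx) (hr _ hy)

theorem IsSelfDual.sdiff {d : ℕ} {β : Finset ℕ} (hβ : IsSelfDual d β) :
    IsSelfDual d (Finset.Icc 1 (2 * d) \ β) := by
  intro j hj
  have := hβ j hj
  have := starIndex_mem hj
  simp only [Finset.mem_sdiff]
  tauto

/-- Exchanging `P` and `Q` exchanges the roles of `β` and its complement; this transports the
negative case to the positive one. -/
theorem IsReflexiveRow.swap {d : ℕ} {β : Finset ℕ} {R : List ℕ × List ℕ}
    (h : IsReflexiveRow d (Finset.Icc 1 (2 * d) \ β) R) : IsReflexiveRow d β R.swap := by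
  obtain ⟨h1, h2, h3⟩ := h
  refine ⟨fun j hj => Finset.mem_sdiff.1 (h2 j hj).2, fun j hj => ⟨(h1 j hj).1, ?_⟩, fun j hj => ?_⟩
  · have := h1 j hj
    rw [Finset.mem_sdiff] at this
    tauto
  · have := h3 _ (starIndex_mem hj)
    rw [starIndex_starIndex hj] at this
    exact this.symm

theorem headD_flipBitableau (T : NotchedBitableau) :
    (flipBitableau T).headD ([], []) = (T.getLastD ([], [])).swap := by
  rw [flipBitableau, List.headD_eq_head?_getD, List.head?_reverse, List.getLast?_map,
    List.getLastD_eq_getLast?]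
  cases T.getLast? <;> rfl

theorem getLastD_flipBitableau (T : NotchedBitableau) :
    (flipBitableau T).getLastD ([], []) = (T.headD ([], [])).swap := by
  rw [flipBitableau, List.getLastD_eq_getLast?, List.getLast?_reverse, List.head?_map,
    List.headD_eq_head?_getD]
  cases T.head? <;> rfl

theorem isReflexiveRow_chainBitableau {d : ℕ} {β : Finset ℕ} (hβ : IsSelfDual d β)
    {C : List (ℕ × ℕ)} (hC : C.Pairwise Nested) (hr : ∀ x ∈ C, InRange d x)
    (hCβ : ∀ x ∈ C, x.1 ∉ β ∧ x.2 ∈ β) :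
    IsReflexiveRow d β ((chainBitableau d C).headD ([], [])) ∧
      IsReflexiveRow d β ((chainBitableau d C).getLastD ([], [])) := by
  obtain ⟨n1, n2⟩ := isReflexiveRow_brskNeg_negativePart hβ hC hr hCβ
  obtain ⟨p1, p2⟩ := isReflexiveRow_brskNeg_negativePart (C := C.map Prod.swap) hβ.sdiff
    (List.pairwise_map.2 (hC.imp fun h => by
      rcases h with h | h
      · exact Or.inr h.symm
      · exact Or.inl h.symm))
    (fun x hx => by
      obtain ⟨y, hy, rfl⟩ := List.mem_map.1 hx
      exact (hr y hy).symm)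
    (fun x hx => by
      obtain ⟨y, hy, rfl⟩ := List.mem_map.1 hx
      have h1 := hCβ y hy
      have h2 := hr y hy
      simp only [Finset.mem_sdiff, Prod.fst_swap, Prod.snd_swap]
      exact ⟨fun h => h.2 h1.2, h2.1, h1.1⟩)
  -- Swapping coordinates commutes with `#` and turns positive pairs into negative ones.
  have e : negativePart (((C.map Prod.swap : List (ℕ × ℕ)) : Multiset (ℕ × ℕ)) +
        hashMultiset d ((C.map Prod.swap : List (ℕ × ℕ)) : Multiset (ℕ × ℕ))) =
      (positivePart ((C : Multiset (ℕ × ℕ)) + hashMultiset d C)).map Prod.swap := by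
    have e' : ((C.map Prod.swap : List (ℕ × ℕ)) : Multiset (ℕ × ℕ)) +
        hashMultiset d ((C.map Prod.swap : List (ℕ × ℕ)) : Multiset (ℕ × ℕ)) =
        ((C : Multiset (ℕ × ℕ)) + hashMultiset d C).map Prod.swap := by
      rw [Multiset.map_add, hashMultiset, hashMultiset, ← Multiset.map_coe, Multiset.map_map,
        Multiset.map_map]
      rfl
    rw [e', negativePart, positivePart, Multiset.filter_map]
    rfl
  rw [e] at p1 p2
  replace p1 := p1.swap
  replace p2 := p2.swap
  rw [← getLastD_flipBitableau] at p1
  rw [← headD_flipBitableau] at p2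
  rw [chainBitableau, BRSK, brskPos]
  constructor
  -- If one of the two parts is empty, the extreme row comes from the other part, or is the default
  -- empty row.
  · generalize brskNeg (negativePart _) = T at n1
    cases T with
    | nil => exact p2
    | cons R T => exact n1
  · generalize flipBitableau _ = T at p1
    rw [List.getLastD_eq_getLast?, List.getLast?_append]
    rw [List.getLastD_eq_getLast?] at n2 p1
    generalize T.getLast? = o at p1
    cases o with
    | none => exact n2
    | some R => exact p1

/-! ### Membership in `I(d)`. -/

theorem mem_symplecticIndexSets_of_isSelfDual {d : ℕ} {v : Finset ℕ}
    (hv : v ⊆ Finset.Icc 1 (2 * d)) (h : IsSelfDual d v) : v ∈ symplecticIndexSets d := by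
  refine ⟨⟨hv, ?_⟩, fun j hj => ?_⟩
  -- The star maps `v` bijectively onto its complement, so `2|v| = 2d`.
  · have hinj : Set.InjOn (starIndex d) v := fun x hx y hy e => by
      rw [← starIndex_starIndex (hv hx), e, starIndex_starIndex (hv hy)]
    have himg : v.image (starIndex d) = Finset.Icc 1 (2 * d) \ v := by
      ext j
      rw [Finset.mem_image, Finset.mem_sdiff]
      constructor
      · rintro ⟨i, hi, rfl⟩
        exact ⟨starIndex_mem (hv hi), fun hm => (h i (hv hi)).1 hm hi⟩
      · rintro ⟨hj, hjv⟩
        exact ⟨starIndex d j, (h j hj).2 hjv, starIndex_starIndex hj⟩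
    have h1 := Finset.card_image_of_injOn hinj
    have h2 := Finset.card_sdiff_add_card_eq_card hv
    rw [← himg, h1, Nat.card_Icc] at h2
    omega
  · have := h j hj
    rw [Xor]
    tauto

/-- For `j ∉ β`, adding `j` through `R` happens exactly when `j^*` is removed through `S`, so each
pair `j`, `j^*` still contributes one element. -/
theorem rowMinus_mem_symplecticIndexSets {d : ℕ} {β : Finset ℕ}
    (hβ : β ⊆ Finset.Icc 1 (2 * d)) (hd : IsSelfDual d β) {R : List ℕ × List ℕ}
    (h : IsReflexiveRow d β R) : rowMinus β R ∈ symplecticIndexSets d := by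
  obtain ⟨h1, h2, h3⟩ := h
  refine mem_symplecticIndexSets_of_isSelfDual ?_ fun j hj => ?_
  · intro j hj
    simp only [rowMinus, Finset.mem_union, Finset.mem_sdiff, List.mem_toFinset] at hj
    rcases hj with hj | hj
    · exact hβ hj.1
    · exact (h1 j hj).1
  · have e1 := h3 j hj
    have e2 := h3 _ (starIndex_mem hj)
    rw [starIndex_starIndex hj] at e2
    have e3 := hd j hj
    have e4 := fun hm => (h1 j hm).2
    have e5 := fun hm => (h2 j hm).2
    simp only [rowMinus, Finset.mem_union, Finset.mem_sdiff, List.mem_toFinset]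
    tauto

theorem theorem3p1 (d : ℕ) (hd : 0 < d) (β : Finset ℕ) (hβ : β ∈ symplecticIndexSets d)
    (C : List (ℕ × ℕ)) (hC : IsExtendedUpperChain d β C) :
    chainTop d β C ∈ symplecticIndexSets d ∧ chainBot d β C ∈ symplecticIndexSets d := by
  obtain ⟨⟨hsub, -⟩, hxor⟩ := hβ
  have hdual : IsSelfDual d β := fun j hj => by
    have := hxor j hj
    rw [Xor] at this
    tauto
  obtain ⟨⟨hmem, hchain⟩, -⟩ := hC
  have : Trans PairGT PairGT PairGT := ⟨fun h1 h2 => ⟨h2.1.trans h1.1, h1.2.trans h2.2⟩⟩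
  have hnest : C.Pairwise Nested := hchain.pairwise.imp fun h => Or.inr h
  have key := isReflexiveRow_chainBitableau hdual hnest
    (fun x hx => ⟨(Finset.mem_sdiff.1 (hmem x hx).1).1, hsub (hmem x hx).2⟩)
    (fun x hx => ⟨(Finset.mem_sdiff.1 (hmem x hx).1).2, (hmem x hx).2⟩)
  exact ⟨rowMinus_mem_symplecticIndexSets hsub hdual key.2,
    rowMinus_mem_symplecticIndexSets hsub hdual key.1⟩
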